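/- **Theorem 1.3 (strong law of large numbers for the multi-colour generalized allocation scheme).** Let $K\ge 1$ be an integer (the number of colours). For each $1\le i\le K$ let $b_{i0},b_{i1},b_{i2},\dots$ be non-negative numbers with $b_{i0}>0$, $b_{i1}>0$, such that the radius of convergence $R_i\in[0,\infty]$ of $$B_i(\theta)=\sum_{k=0}^\infty \frac{b_{ik}\theta^k}{k!}$$ is positive. For $\theta>0$ with $B_i(\theta)<\infty$ let $\xi_i(\theta)$ be a random variable with $$\mathbb P\{\xi_i(\theta)=k\}=\frac{b_{ik}\theta^k}{k!\,B_i(\theta)},\qquad k=0,1,2,\dots,$$ and let $m_i(\theta)=\mathbb E\,\xi_i(\theta)$. For $\mathbf n=(n_1,\dots,n_K)$ with non-negative integer entries and an integer $N\ge 0$, let $\xi_{ij}$ $(1\le i\le K,\ 1\le j\le N)$ be independent, $\xi_{ij}$ being distributed as $\xi_i(\theta_i)$, where the parameters $\theta_i>0$ with $B_i(\theta_i)<\infty$ may depend on $(\mathbf n,N)$. Whenever $\mathbb P\{\xi_{i1}+\dots+\xi_{iN}=n_i\}>0$ for all $i$, let $\eta_{ij}=\eta_{ij}^{(\mathbf n,N)}$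 $(1\le i\le K,\ 1\le j\le N)$ be non-negative integer-valued random variables with $$\mathbb P\{\eta_{ij}=k_{ij}\ \text{for all } i,j\}=\prod_{i=1}^K \mathbb P\{\xi_{i1}=k_{i1},\dots,\xi_{iN}=k_{iN}\mid \xi_{i1}+\dots+\xi_{iN}=n_i\}$$ for all non-negative integers $k_{ij}$ with $k_{i1}+\dots+k_{iN}=n_i$, $1\le i\le K$ (so $\eta_{ij}$ is the number of balls of colour $i$ in box $j$). For the remaining pairs $(\mathbf n,N)$ the $\eta_{ij}^{(\mathbf n,N)}$ are arbitrary. All these variables, for all $(\mathbf n,N)$, are defined on one probability space; nothing is assumed about the joint distribution for different $(\mathbf n,N)$. For $\mathbf s=(s_1,\dots,s_K)$ with non-negative integer entries let $$\mu_{\mathbf s\mathbf nN}=\sum_{j=1}^N\prod_{i=1}^K\mathbb I_{\{\eta_{ij}=s_i\}}$$ be the number of boxes containing exactly $s_i$ balls of colour $i$ for every $i$. Fix $\mathbf s$, and for each $1\le i\le K$ let $0<\theta_{\alpha_{i0}}<R_i$ and $\alpha_{i0}=m_i(\theta_{\alpha_{i0}})$. Then, almost surely, $$\frac1N\,\mu_{\mathbf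 s\mathbf nN}\ \longrightarrow\ \prod_{i=1}^K\frac{b_{is_i}\,\theta_{\alpha_{i0}}^{s_i}}{s_i!\,B_i(\theta_{\alpha_{i0}})}$$ as $N\to\infty$, $n_i\to\infty$ and $n_i/N\to\alpha_{i0}$ for all $1\le i\le K$. The limit is a multi-index limit: outside one event of probability zero, the convergence holds along every sequence of pairs $(\mathbf n,N)$ in this regime. -/

import Mathlib

open MeasureTheory ProbabilityTheory Filter Topology
open scoped Nat ENNReal

noncomputable section

namespace ColouredAllocation

/-- `B(θ) = ∑ₖ bₖ θᵏ / k!`. -/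
def genFun (b : ℕ → ℝ) (θ : ℝ) : ℝ := ∑' k : ℕ, b k * θ ^ k / (k ! : ℝ)

/-- The radius of convergence, in `[0, ∞]`, of the power series `∑ₖ (bₖ / k!) θᵏ`. -/
def convRadius (b : ℕ → ℝ) : ℝ≥0∞ :=
  (FormalMultilinearSeries.ofScalars ℝ (fun k : ℕ => b k / (k ! : ℝ))).radius

/-- The weight `bₖ θᵏ / (k! B(θ))` of `k` under the power series distribution with parameter
`θ`. -/
def weight (b : ℕ → ℝ) (θ : ℝ) (k : ℕ) : ℝ := b k * θ ^ k / ((k ! : ℝ) * genFun b θ)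

/-- The expectation `m(θ)` of the power series distribution with parameter `θ`. -/
def mean (b : ℕ → ℝ) (θ : ℝ) : ℝ := ∑' k : ℕ, (k : ℝ) * weight b θ k

/-- `ξ i j` (colour `i`, box `j`) is an array of independent random variables with values in the
non-negative integers; those of colour `i` have the power series distribution given by the sequence
`b i` and the parameter `θ i > 0`, whose normalising series converges. -/
structure IsPowerSeriesArray {Ω : Type*} [MeasurableSpace Ω] (Q : Measure Ω) {K N : ℕ}
    (b : Fin K → ℕ → ℝ) (θ : Fin K → ℝ) (ξ : Fin K → Fin N → Ω → ℕ) : Prop where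
  param_pos : ∀ i, 0 < θ i
  summable : ∀ i, Summable fun k : ℕ => b i k * θ i ^ k / (k ! : ℝ)
  measurable : ∀ i j, Measurable (ξ i j)
  indep : iIndepFun (fun (p : Fin K × Fin N) => ξ p.1 p.2) Q
  law : ∀ i j k, Q.real {ω | ξ i j ω = k} = weight (b i) (θ i) k

/-- The event that the variables of colour `i` add up to `m`. -/
def totalEvent {Ω : Type*} {K N : ℕ} (ξ : Fin K → Fin N → Ω → ℕ) (i : Fin K) (m : ℕ) : Set Ω :=
  {ω | ∑ j, ξ i j ω = m}

/-- The random variables `η i j` (number of balls of colour `i` in box `j`) obey the multi-colour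
generalized allocation scheme of placing `n i` balls of colour `i`, for each `i`, into `N` boxes,
with underlying array `ξ`. The arrays `η` and `ξ` may live on different probability spaces. -/
structure IsAllocationScheme {Ω Ω' : Type*} [MeasurableSpace Ω] [MeasurableSpace Ω']
    (P : Measure Ω) (Q : Measure Ω') {K N : ℕ} (n : Fin K → ℕ)
    (ξ : Fin K → Fin N → Ω' → ℕ) (η : Fin K → Fin N → Ω → ℕ) : Prop where
  measurable : ∀ i j, Measurable (η i j)
  joint_law : ∀ k : Fin K → Fin N → ℕ, (∀ i, ∑ j, k i j = n i) →
    P {ω | ∀ i j, η i j ω = k i j} =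
      ∏ i, ProbabilityTheory.cond Q (totalEvent ξ i (n i)) {ω | ∀ j, ξ i j ω = k i j}

/-- The number of boxes which contain exactly `s i` balls of colour `i` for every colour `i`. -/
def boxCount {Ω : Type*} {K N : ℕ} (η : Fin K → Fin N → Ω → ℕ) (s : Fin K → ℕ) (ω : Ω) : ℕ :=
  ∑ j, if ∀ i, η i j ω = s i then 1 else 0

/-- The limit regime for pairs `(n, N)`: `N → ∞` and, for each colour `i`, `n i → ∞` and
`n i / N → α i`. -/
def regime {K : ℕ} (α : Fin K → ℝ) : Filter ((Fin K → ℕ) × ℕ) :=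
  comap (fun p => p.2) atTop ⊓
    ((⨅ i, comap (fun p => p.1 i) atTop) ⊓
      ⨅ i, comap (fun p => (p.1 i : ℝ) / (p.2 : ℝ)) (𝓝 (α i)))

end ColouredAllocation

end

namespace ColouredAllocation

/-! Conditionally on its total, the row of one colour has a law that does not depend on the
parameter (`exists_prod_weight_eq`), so every scheme can be computed with the fixed parameters `θ₀
i`. Then an event has in the scheme at most its probability for independent variables, divided by
the product over the colours of the probabilities of the prescribed totals
(`measureReal_scheme_le`). For independent variables the box count is a sum of `N` i.i.d.
indicators, and Hoeffding's inequality bounds a deviation `ε * N` by `2 * exp (-2 ε² N)`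
(`sum_prod_weight_le`).

Hence no local limit theorem is needed: it suffices that each total has probability at least `exp
(-δ N)`, for any prescribed `δ > 0`, once `n i / N` is close enough to the mean
(`exp_neg_le_totalWeight`). To see this, leave most variables free; by the weak law their sum is
near its mean with probability at least 1/2. A small proportion of the variables, restricted to the
values 0, 1 and some `M` above the mean, then corrects the total exactly, at a cost exponential only
in their number.

With `δ = ε² / K` the quotient is at most `2 * exp (-ε² N)`. For each `N` only polynomially many
vectors `n` matter, so Borel–Cantelli over `N` alone yields the multi-index limit
(`ae_eventually_regime_abs_sub_lt`). -/

/-! ### Convolution powers of a weight sequence. -/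

/-- The probability that `N` independent variables with weights `w` have sum `n`. -/
noncomputable def totalWeight (w : ℕ → ℝ) (N n : ℕ) : ℝ :=
  ∑ k ∈ Finset.piAntidiag (Finset.univ : Finset (Fin N)) n, ∏ j, w (k j)

/-- As a coefficient of a power of the generating series, the convolution identity for `N + N'`
variables becomes `pow_add`. -/
theorem totalWeight_eq_coeff (w : ℕ → ℝ) (N n : ℕ) :
    totalWeight w N n = PowerSeries.coeff n (PowerSeries.mk w ^ N) := by
  have h : PowerSeries.mk w ^ N = ∏ _j : Fin N, PowerSeries.mk w := by simp
  rw [h, PowerSeries.coeff_prod, totalWeight]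
  symm
  refine Finset.sum_bij (fun f _ => ⇑f) ?_ ?_ ?_ ?_
  · intro f hf
    simpa [Finset.mem_finsuppAntidiag] using hf
  · intro f _ g _ hfg
    exact DFunLike.coe_injective hfg
  · intro k hk
    refine ⟨Finsupp.equivFunOnFinite.symm k, ?_, by simp⟩
    simpa [Finset.mem_finsuppAntidiag] using hk
  · intro f _
    simp

theorem totalWeight_nonneg {w : ℕ → ℝ} (hw : ∀ k, 0 ≤ w k) (N n : ℕ) : 0 ≤ totalWeight w N n :=
  Finset.sum_nonneg fun _ _ => Finset.prod_nonneg fun _ _ => hw _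

theorem totalWeight_add (w : ℕ → ℝ) (N N' n : ℕ) :
    totalWeight w (N + N') n =
      ∑ p ∈ Finset.HasAntidiagonal.antidiagonal n, totalWeight w N p.1 * totalWeight w N' p.2 := by
  simp only [totalWeight_eq_coeff, pow_add, PowerSeries.coeff_mul]

theorem totalWeight_mul_le {w : ℕ → ℝ} (hw : ∀ k, 0 ≤ w k) (N N' n n' : ℕ) :
    totalWeight w N n * totalWeight w N' n' ≤ totalWeight w (N + N') (n + n') := by
  rw [totalWeight_add]
  exact Finset.single_le_sum (f := fun p : ℕ × ℕ => totalWeight w N p.1 * totalWeight w N' p.2)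
    (fun p _ => mul_nonneg (totalWeight_nonneg hw _ _) (totalWeight_nonneg hw _ _))
    (a := (n, n')) (by simp)

theorem pow_le_totalWeight_mul {w : ℕ → ℝ} (hw : ∀ k, 0 ≤ w k) (a m : ℕ) :
    w m ^ a ≤ totalWeight w a (a * m) := by
  refine le_trans (by simp) (Finset.single_le_sum (f := fun k : Fin a → ℕ => ∏ j, w (k j))
    (fun _ _ => Finset.prod_nonneg fun _ _ => hw _) (a := fun _ => m) (by simp))

/-- Every total that is not too large is reached by variables with values in `{0, 1, M}`. -/
theorem pow_le_totalWeight {w : ℕ → ℝ} (hw : ∀ k, 0 ≤ w k) {q : ℝ} (hq : 0 ≤ q) {M : ℕ}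
    (hM : 0 < M) (h0 : q ≤ w 0) (h1 : q ≤ w 1) (hqM : q ≤ w M) {r t : ℕ}
    (ht : t + M * M ≤ M * r) : q ^ r ≤ totalWeight w r t := by
  have hdm := Nat.div_add_mod t M
  have hmod := Nat.mod_lt t hM
  set a := t / M
  set c := t % M
  -- `a` variables take the value `M`, `c` the value 1 and the rest 0. The slack `M * M` pays for
  -- the remainder: it gives `a + M ≤ r`, and `c < M`.
  have hac : a + c ≤ r := by
    have : M * (a + M) ≤ M * r := by rw [mul_add]; omega
    have := Nat.le_of_mul_le_mul_left this hM
    omega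
  obtain ⟨d, rfl⟩ := Nat.exists_eq_add_of_le hac
  have e : t = a * M + c * 1 + d * 0 := by rw [mul_comm a M]; omega
  rw [e, pow_add, pow_add]
  have k1 := totalWeight_mul_le hw (a + c) d (a * M + c * 1) (d * 0)
  have k2 := totalWeight_mul_le hw a c (a * M) (c * 1)
  refine le_trans ?_ k1
  refine mul_le_mul ((le_trans ?_ k2)) ?_ (by positivity) (totalWeight_nonneg hw _ _)
  · exact mul_le_mul ((pow_le_pow_left₀ hq hqM _).trans (pow_le_totalWeight_mul hw _ _))
      ((pow_le_pow_left₀ hq h1 _).trans (pow_le_totalWeight_mul hw _ _)) (by positivity)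
      (totalWeight_nonneg hw _ _)
  · exact (pow_le_pow_left₀ hq h0 _).trans (pow_le_totalWeight_mul hw _ _)

/-! ### Sums of independent variables and the weak law. -/

/-- The law of the sum of finitely many random natural numbers in terms of their joint law. -/
theorem measure_sum_eq {Ω : Type*} [MeasurableSpace Ω] (μ : Measure Ω) {N : ℕ}
    {X : Fin N → Ω → ℕ} (hX : ∀ j, Measurable (X j)) (n : ℕ) :
    μ {ω | ∑ j, X j ω = n} =
      ∑ k ∈ Finset.piAntidiag (Finset.univ : Finset (Fin N)) n, μ {ω | ∀ j, X j ω = k j} := by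
  have h : {ω | ∑ j, X j ω = n} =
      ⋃ k ∈ Finset.piAntidiag (Finset.univ : Finset (Fin N)) n, {ω | ∀ j, X j ω = k j} := by
    ext ω
    simp only [Set.mem_ofPred_eq, Set.mem_iUnion, Finset.mem_piAntidiag, exists_prop]
    constructor
    · intro h
      exact ⟨fun j => X j ω, ⟨h, by simp⟩, fun _ => rfl⟩
    · rintro ⟨k, ⟨h, -⟩, hk⟩
      simpa [hk] using h
  rw [h, measure_biUnion_finset]
  · intro k _ k' _ hkk'
    refine Set.disjoint_left.2 fun ω h h' => hkk' ?_
    funext j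
    exact (h j).symm.trans (h' j)
  · intro k _
    rw [Set.ofPred_forall]
    exact MeasurableSet.iInter fun j => hX j (measurableSet_singleton _)

/-- The joint law of independent random natural numbers. -/
theorem measureReal_forall_eq {Ω ι : Type*} [Fintype ι] [MeasurableSpace Ω] {μ : Measure Ω}
    {X : ι → Ω → ℕ} (hind : iIndepFun X μ) (k : ι → ℕ) :
    μ.real {ω | ∀ j, X j ω = k j} = ∏ j, μ.real {ω | X j ω = k j} := by
  have h := hind.measure_inter_preimage_eq_mul Finset.univ (sets := fun j => {k j})
    (fun j _ => measurableSet_singleton _)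
  have e : {ω | ∀ j, X j ω = k j} = ⋂ j ∈ (Finset.univ : Finset ι), X j ⁻¹' {k j} := by
    ext ω; simp
  rw [e, measureReal_def, h, ENNReal.toReal_prod]
  rfl

theorem measureReal_sum_eq {Ω : Type*} [MeasurableSpace Ω] {μ : Measure Ω} [IsFiniteMeasure μ]
    {N : ℕ} {X : Fin N → Ω → ℕ} (hX : ∀ j, Measurable (X j)) (hind : iIndepFun X μ)
    {w : ℕ → ℝ} (hw : ∀ j k, μ.real {ω | X j ω = k} = w k) (n : ℕ) :
    μ.real {ω | ∑ j, X j ω = n} = totalWeight w N n := by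
  rw [measureReal_def, measure_sum_eq μ hX, ENNReal.toReal_sum (fun _ _ => measure_ne_top _ _)]
  refine Finset.sum_congr rfl fun k _ => ?_
  rw [← measureReal_def, measureReal_forall_eq hind]
  simp [hw]

/-- The measure on `ℕ` with point masses `w k`. -/
noncomputable def weightMeasure (w : ℕ → ℝ) : Measure ℕ :=
  Measure.sum fun k => ENNReal.ofReal (w k) • Measure.dirac k

theorem weightMeasure_singleton (w : ℕ → ℝ) (k : ℕ) :
    weightMeasure w {k} = ENNReal.ofReal (w k) := by
  rw [weightMeasure, Measure.sum_apply _ (measurableSet_singleton k), tsum_eq_single k]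
  · simp
  · intro m hm
    simp [hm]

theorem isProbabilityMeasure_weightMeasure {w : ℕ → ℝ} (hw : ∀ k, 0 ≤ w k) (h1 : HasSum w 1) :
    IsProbabilityMeasure (weightMeasure w) := by
  constructor
  rw [weightMeasure, Measure.sum_apply _ MeasurableSet.univ]
  simp only [Measure.smul_apply, measure_univ, smul_eq_mul, mul_one]
  rw [← ENNReal.ofReal_tsum_of_nonneg hw h1.summable, h1.tsum_eq, ENNReal.ofReal_one]

theorem integrable_weightMeasure {w : ℕ → ℝ} (hw : ∀ k, 0 ≤ w k)
    (hs : Summable fun k : ℕ => (k : ℝ) * w k) :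
    Integrable (fun k : ℕ => (k : ℝ)) (weightMeasure w) := by
  refine integrable_sum_dirac (fun _ => ENNReal.ofReal_ne_top) (hs.congr fun k => ?_)
  rw [ENNReal.toReal_ofReal (hw k), Real.norm_natCast, mul_comm]

theorem integral_weightMeasure {w : ℕ → ℝ} (hw : ∀ k, 0 ≤ w k)
    (hs : Summable fun k : ℕ => (k : ℝ) * w k) :
    ∫ k : ℕ, (k : ℝ) ∂weightMeasure w = ∑' k : ℕ, (k : ℝ) * w k := by
  rw [weightMeasure, integral_sum_measure (integrable_weightMeasure hw hs)]
  refine tsum_congr fun k => ?_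
  rw [integral_smul_measure, integral_dirac, ENNReal.toReal_ofReal (hw k), smul_eq_mul, mul_comm]

/-- The weak law of large numbers for independent variables with weights `w`. -/
theorem eventually_half_le_sum_totalWeight {w : ℕ → ℝ} (hw : ∀ k, 0 ≤ w k) (h1 : HasSum w 1)
    {α : ℝ} (hα : HasSum (fun k : ℕ => (k : ℝ) * w k) α) {τ : ℝ} (hτ : 0 < τ) :
    ∀ᶠ N : ℕ in atTop, ∀ T : Finset ℕ, (∀ a : ℕ, |(a : ℝ) - α * N| ≤ τ * N → a ∈ T) →
      1 / 2 ≤ ∑ a ∈ T, totalWeight w N a := by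
  have := isProbabilityMeasure_weightMeasure hw h1
  set μ : Measure (ℕ → ℕ) := Measure.infinitePi fun _ => weightMeasure w
  have hindN : iIndepFun (fun (j : ℕ) (x : ℕ → ℕ) => x j) μ :=
    iIndepFun_infinitePi (X := fun _ x => x) fun _ => measurable_id
  have hindR : iIndepFun (fun (j : ℕ) (x : ℕ → ℕ) => (x j : ℝ)) μ :=
    iIndepFun_infinitePi (X := fun (_ : ℕ) (x : ℕ) => (x : ℝ)) fun _ => measurable_from_top
  have hmap : ∀ j, μ.map (fun x => x j) = weightMeasure w := fun j =>
    Measure.infinitePi_map_eval _ j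
  have hmeas : ∀ j, Measurable fun x : ℕ → ℕ => x j := fun j => measurable_pi_apply j
  have hlaw : ∀ j k, μ.real {x | x j = k} = w k := by
    intro j k
    have e : μ {x | x j = k} = weightMeasure w {k} := by
      rw [← hmap j, Measure.map_apply (hmeas j) (measurableSet_singleton k)]
      rfl
    rw [measureReal_def, e, weightMeasure_singleton, ENNReal.toReal_ofReal (hw k)]
  have hint0 := integrable_weightMeasure hw hα.summable
  have hint : Integrable (fun x : ℕ → ℕ => (x 0 : ℝ)) μ := by
    rw [← hmap 0] at hint0
    exact hint0.comp_measurable (hmeas 0)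
  have hE : ∫ x : ℕ → ℕ, (x 0 : ℝ) ∂μ = α := by
    rw [← hα.tsum_eq, ← integral_weightMeasure hw hα.summable, ← hmap 0,
      integral_map (hmeas 0).aemeasurable measurable_from_top.aestronglyMeasurable]
  have hident : ∀ j, IdentDistrib (fun x : ℕ → ℕ => (x j : ℝ)) (fun x => (x 0 : ℝ)) μ μ := by
    intro j
    have h : IdentDistrib (fun x : ℕ → ℕ => x j) (fun x => x 0) μ μ :=
      ⟨(hmeas j).aemeasurable, (hmeas 0).aemeasurable, by rw [hmap, hmap]⟩
    exact h.comp (u := fun k : ℕ => (k : ℝ)) measurable_from_top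
  -- Almost sure convergence on the infinite product is used only through the convergence in measure
  -- that it implies.
  have hsl := strong_law_ae_real (fun j (x : ℕ → ℕ) => (x j : ℝ)) hint
    (fun i j hij => hindR.indepFun hij) hident
  rw [hE] at hsl
  have hsm : ∀ N : ℕ, Measurable fun x : ℕ → ℕ => (∑ j ∈ Finset.range N, (x j : ℝ)) / N := by
    intro N
    exact (Finset.measurable_sum _ fun j _ => measurable_from_top.comp (hmeas j)).div_const _
  have htm := tendstoInMeasure_of_tendsto_ae (fun N => (hsm N).aestronglyMeasurable) hsl
  rw [tendstoInMeasure_iff_measureReal_dist] at htm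
  have hev := (htm τ hτ).eventually (gt_mem_nhds (show (0 : ℝ) < 1 / 2 by norm_num))
  filter_upwards [hev, eventually_gt_atTop 0] with N hN hN0 T hT
  have hNpos : (0 : ℝ) < N := by exact_mod_cast hN0
  have hsum : ∀ a, μ.real {x | ∑ j : Fin N, x j = a} = totalWeight w N a := fun a =>
    measureReal_sum_eq (X := fun (j : Fin N) (x : ℕ → ℕ) => x j) (fun j => hmeas j)
      (hindN.precomp Fin.val_injective) (fun j k => hlaw j k) a
  have hSm : Measurable fun x : ℕ → ℕ => ∑ j : Fin N, x j :=
    Finset.measurable_sum _ fun j _ => hmeas j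
  have hTm : ∑ a ∈ T, totalWeight w N a = μ.real {x | ∑ j : Fin N, x j ∈ T} := by
    have e : {x : ℕ → ℕ | ∑ j : Fin N, x j ∈ T} = ⋃ a ∈ T, {x | ∑ j : Fin N, x j = a} := by
      ext x; simp
    rw [e, measureReal_biUnion_finset]
    · exact Finset.sum_congr rfl fun a _ => (hsum a).symm
    · intro a _ a' _ haa'
      exact Set.disjoint_left.2 fun x h h' => haa' (h.symm.trans h')
    · exact fun a _ => hSm (measurableSet_singleton a)
  have hTs : MeasurableSet {x : ℕ → ℕ | ∑ j : Fin N, x j ∈ T} :=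
    hSm (T.finite_toSet.measurableSet)
  rw [hTm]
  have hcompl := probReal_compl_eq_one_sub (μ := μ) hTs
  have hle : μ.real {x : ℕ → ℕ | ∑ j : Fin N, x j ∈ T}ᶜ ≤
      μ.real {x | τ ≤ dist ((∑ j ∈ Finset.range N, (x j : ℝ)) / N) α} := by
    refine measureReal_mono (fun x hx => ?_)
    by_contra hlt
    refine hx (hT _ ?_)
    have hlt' : |(∑ j ∈ Finset.range N, (x j : ℝ)) / N - α| < τ := by
      rw [← Real.dist_eq]
      exact not_le.1 hlt
    have e : ((∑ j : Fin N, x j : ℕ) : ℝ) - α * N =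
        ((∑ j ∈ Finset.range N, (x j : ℝ)) / N - α) * N := by
      rw [Finset.sum_range]
      push_cast
      field_simp
    rw [e, abs_mul, abs_of_pos hNpos]
    exact mul_le_mul_of_nonneg_right hlt'.le hNpos.le
  linarith

/-! ### The subexponential lower bound for a prescribed total. -/

/-- The weights reach beyond their mean. -/
theorem exists_mean_lt {w : ℕ → ℝ} (hw : ∀ k, 0 ≤ w k) (h1 : HasSum w 1) (h0 : 0 < w 0)
    {α : ℝ} (hα : HasSum (fun k : ℕ => (k : ℝ) * w k) α) (hpos : 0 < α) :
    ∃ M : ℕ, α < M ∧ 0 < w M := by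
  by_contra! h
  -- Without mass beyond `α`, all terms `(α - k) * w k` are nonnegative and sum to zero, but the
  -- term at `k = 0` is positive.
  have hs : HasSum (fun k : ℕ => α * w k - (k : ℝ) * w k) (α * 1 - α) := (h1.mul_left α).sub hα
  have hnn : ∀ k : ℕ, 0 ≤ α * w k - (k : ℝ) * w k := by
    intro k
    rcases lt_or_ge α k with hk | hk
    · rw [le_antisymm (h k hk) (hw k)]
      simp
    · rw [← sub_mul]
      exact mul_nonneg (sub_nonneg.2 hk) (hw k)
  have := le_hasSum hs 0 fun k _ => hnn k
  have : 0 < α * w 0 := mul_pos hpos h0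
  simp at *
  linarith

/-- A subexponential local lower bound for the law of a sum whose mean is near its value. -/
theorem exp_neg_le_totalWeight {w : ℕ → ℝ} (hw : ∀ k, 0 ≤ w k) (h1 : HasSum w 1) (hw0 : 0 < w 0)
    (hw1 : 0 < w 1) {α : ℝ} (hα : HasSum (fun k : ℕ => (k : ℝ) * w k) α) {δ : ℝ} (hδ : 0 < δ) :
    ∃ ρ > 0, ∀ᶠ N : ℕ in atTop, ∀ n : ℕ, |(n : ℝ) - α * N| ≤ ρ * N →
      Real.exp (-δ * N) ≤ totalWeight w N n := by
  have hpos : 0 < α := by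
    have := le_hasSum hα 1 fun k _ => mul_nonneg (Nat.cast_nonneg k) (hw k)
    simp at this
    linarith
  obtain ⟨M, hαM, hwM⟩ := exists_mean_lt hw h1 hw0 hα hpos
  have hMpos : 0 < M := by
    have : (0 : ℝ) < M := hpos.trans hαM
    exact_mod_cast this
  set q := min (min (w 0) (w 1)) (w M)
  have hq : 0 < q := lt_min (lt_min hw0 hw1) hwM
  have hq0 : q ≤ w 0 := (min_le_left _ _).trans (min_le_left _ _)
  have hq1' : q ≤ w 1 := (min_le_left _ _).trans (min_le_right _ _)
  have hqM : q ≤ w M := min_le_right _ _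
  have hq1 : q ≤ 1 := hq0.trans (le_hasSum h1 0 fun k _ => hw k)
  set l := -Real.log q
  have hl : 0 ≤ l := neg_nonneg.2 (Real.log_nonpos hq.le hq1)
  -- `κ` is the proportion of correcting variables: their cost `q ^ (κ N)` uses half of the exponent
  -- `δ`, and `κ ≤ 1 / 2` keeps the number of free variables unbounded.
  obtain ⟨κ, hκ0, hκ1, hκl⟩ : ∃ κ : ℝ, 0 < κ ∧ κ ≤ 1 / 2 ∧ l * κ ≤ δ / 2 := by
    refine ⟨min (1 / 2) (δ / (2 * (l + 1))), lt_min (by norm_num) (by positivity),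
      min_le_left _ _, ?_⟩
    calc l * min (1 / 2) (δ / (2 * (l + 1))) ≤ l * (δ / (2 * (l + 1))) :=
          mul_le_mul_of_nonneg_left (min_le_right _ _) hl
      _ ≤ (l + 1) * (δ / (2 * (l + 1))) :=
          mul_le_mul_of_nonneg_right (by linarith) (by positivity)
      _ = δ / 2 := by field_simp
  -- The residual `n - a` differs from `α * r` by at most `2 * ρ * N`. The second bound keeps it
  -- nonnegative; the first keeps it below `M * r` by at least `(M - α) * κ * N / 2`, which
  -- eventually exceeds `M * M`.
  set ρ := min ((M - α) * κ / 4) (α * κ / 2)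
  have hρ : 0 < ρ := lt_min (by have := sub_pos.2 hαM; positivity) (by positivity)
  have hρ1 : ρ ≤ (M - α) * κ / 4 := min_le_left _ _
  have hρ2 : ρ ≤ α * κ / 2 := min_le_right _ _
  refine ⟨ρ, hρ, ?_⟩
  have hsub : Tendsto (fun N : ℕ => N - ⌈κ * N⌉₊) atTop atTop := by
    refine tendsto_atTop_mono (f := fun N : ℕ => N / 2 - 1) (fun N => ?_) ?_
    · have : ⌈κ * (N : ℝ)⌉₊ ≤ N / 2 + 1 := by
        refine Nat.ceil_le.2 ?_
        have h2 : ((N : ℝ)) ≤ 2 * ((N / 2 : ℕ) : ℝ) + 1 := by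
          have : N ≤ 2 * (N / 2) + 1 := by omega
          exact_mod_cast this
        have : κ * (N : ℝ) ≤ 1 / 2 * N := mul_le_mul_of_nonneg_right hκ1 (Nat.cast_nonneg _)
        push_cast
        linarith
      show N / 2 - 1 ≤ N - ⌈κ * (N : ℝ)⌉₊
      omega
    · exact tendsto_atTop.2 fun B => by
        filter_upwards [eventually_ge_atTop (2 * (B + 1))] with N hN
        omega
  have hbig : ∀ C D : ℝ, 0 < C → ∀ᶠ N : ℕ in atTop, D ≤ C * (N : ℝ) := fun C D hC =>
    (tendsto_natCast_atTop_atTop.const_mul_atTop hC).eventually_ge_atTop D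
  -- The last condition absorbs the factor 1/2 from the weak law and the one extra factor `q` caused
  -- by rounding `κ * N` up.
  filter_upwards [hsub.eventually (eventually_half_le_sum_totalWeight hw h1 hα hρ),
    hbig ((M - α) * κ / 2) (M * M) (by have := sub_pos.2 hαM; positivity),
    hbig (δ / 2) (l + Real.log 2) (by positivity)] with N hN hN1 hN2 n hn
  set r := ⌈κ * (N : ℝ)⌉₊
  have hNnn : (0 : ℝ) ≤ N := Nat.cast_nonneg N
  have hr1 : κ * N ≤ r := Nat.le_ceil _
  have hr2 : (r : ℝ) ≤ κ * N + 1 := (Nat.ceil_lt_add_one (by positivity)).le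
  have hrN : r ≤ N := Nat.ceil_le.2 (by nlinarith)
  have hcast : ((N - r : ℕ) : ℝ) = N - r := Nat.cast_sub hrN
  -- Totals of the free variables that the correcting variables can complete to `n`; the range
  -- ensures that `n - a` is not truncated.
  set T : Finset ℕ := (Finset.range (n + 1)).filter fun a => n - a + M * M ≤ M * r
  have hT : 1 / 2 ≤ ∑ a ∈ T, totalWeight w (N - r) a := by
    refine hN T fun a ha => ?_
    rw [hcast] at ha
    obtain ⟨ha1, ha2⟩ := abs_le.1 ha
    obtain ⟨hn1, hn2⟩ := abs_le.1 hn
    have hρr : ρ * (N - r) ≤ ρ * N := mul_le_mul_of_nonneg_left (by linarith [r.cast_nonneg (α := ℝ)]) hρ.le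
    have hρN1 : ρ * N ≤ (M - α) * κ / 4 * N := mul_le_mul_of_nonneg_right hρ1 hNnn
    have hρN2 : ρ * N ≤ α * κ / 2 * N := mul_le_mul_of_nonneg_right hρ2 hNnn
    have hαr : α * (κ * N) ≤ α * r := mul_le_mul_of_nonneg_left hr1 hpos.le
    have hMr : (M - α) * (κ * N) ≤ (M - α) * r :=
      mul_le_mul_of_nonneg_left hr1 (sub_pos.2 hαM).le
    have han : a ≤ n := by
      have : (a : ℝ) ≤ n := by linarith
      exact_mod_cast this
    simp only [T, Finset.mem_filter, Finset.mem_range]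
    refine ⟨by omega, ?_⟩
    have : ((n - a : ℕ) : ℝ) + M * M ≤ M * r := by
      rw [Nat.cast_sub han]
      linarith
    exact_mod_cast this
  have hTs : (1 / 2) * q ^ r ≤ totalWeight w N n := by
    calc (1 / 2) * q ^ r ≤ (∑ a ∈ T, totalWeight w (N - r) a) * q ^ r :=
          mul_le_mul_of_nonneg_right hT (by positivity)
      _ ≤ ∑ a ∈ T, totalWeight w (N - r) a * totalWeight w r (n - a) := by
          rw [Finset.sum_mul]
          refine Finset.sum_le_sum fun a ha => mul_le_mul_of_nonneg_left ?_ (totalWeight_nonneg hw _ _)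
          exact pow_le_totalWeight hw hq.le hMpos hq0 hq1' hqM (Finset.mem_filter.1 ha).2
      _ ≤ ∑ a ∈ Finset.range (n + 1), totalWeight w (N - r) a * totalWeight w r (n - a) :=
          Finset.sum_le_sum_of_subset_of_nonneg (Finset.filter_subset _ _) fun a _ _ =>
            mul_nonneg (totalWeight_nonneg hw _ _) (totalWeight_nonneg hw _ _)
      _ = totalWeight w N n := by
          conv_rhs => rw [← Nat.sub_add_cancel hrN]
          rw [totalWeight_add]
          exact (Finset.Nat.sum_antidiagonal_eq_sum_range_succ
            (fun a c => totalWeight w (N - r) a * totalWeight w r c) n).symm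
  refine le_trans ?_ hTs
  have hqr : (1 / 2) * q ^ r = Real.exp (-Real.log 2 + r * Real.log q) := by
    rw [Real.exp_add, Real.exp_neg, Real.exp_log two_pos, Real.exp_nat_mul, Real.exp_log hq]
    norm_num
  rw [hqr, Real.exp_le_exp]
  have e : Real.log q = -l := by simp [l]
  have : l * r ≤ l * (κ * N + 1) := mul_le_mul_of_nonneg_left hr2 hl
  have : l * κ * N ≤ δ / 2 * N := mul_le_mul_of_nonneg_right hκl hNnn
  rw [e]
  linarith

/-! ### Exponential concentration for independent variables. -/

/-- Hoeffding's inequality, two-sided, for the number of occurrences of independent events of equal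
probability. -/
theorem measureReal_abs_count_sub_le {N : ℕ} {S : Type*} [MeasurableSpace S] (ν : Measure S)
    [IsProbabilityMeasure ν] {A : Set S} (hA : MeasurableSet A) {ε : ℝ} (hε : 0 ≤ ε) :
    (Measure.pi fun _ : Fin N => ν).real
        {x | ε * N ≤ |∑ j, A.indicator (fun _ => (1 : ℝ)) (x j) - ν.real A * N|} ≤
      2 * Real.exp (-(2 * ε ^ 2) * N) := by
  set μ := Measure.pi fun _ : Fin N => ν
  set f : S → ℝ := A.indicator fun _ => (1 : ℝ)
  have hf : Measurable f := measurable_const.indicator hA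
  have hE : ∫ x, f x ∂ν = ν.real A := by
    simp [f, integral_indicator hA]
  -- An indicator lies in `[0, 1]`, so its variance proxy is 1/4; the sum has proxy `N / 4`, whence
  -- the exponent `2 * ε ^ 2 * N`.
  have hsub : HasSubgaussianMGF (fun x => f x - ν.real A) ((‖(1 : ℝ) - 0‖₊ / 2) ^ 2) ν := by
    rw [← hE]
    refine hasSubgaussianMGF_of_mem_Icc hf.aemeasurable (ae_of_all _ fun x => ?_)
    by_cases hx : x ∈ A <;> simp [f, hx]
  have hmp : ∀ j, MeasurePreserving (fun x : Fin N → S => x j) μ ν := fun j =>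
    measurePreserving_eval (fun _ => ν) j
  have hsubj : ∀ j, HasSubgaussianMGF (fun x : Fin N → S => f (x j) - ν.real A)
      ((‖(1 : ℝ) - 0‖₊ / 2) ^ 2) μ := by
    intro j
    refine HasSubgaussianMGF.of_map (Y := fun x : Fin N → S => x j)
      (X := fun x => f x - ν.real A) (hmp j).measurable.aemeasurable ?_
    rw [(hmp j).map_eq]
    exact hsub
  have hind : iIndepFun (fun (j : Fin N) (x : Fin N → S) => f (x j) - ν.real A) μ :=
    iIndepFun_pi (X := fun (_ : Fin N) (x : S) => f x - ν.real A)
      fun _ => (hf.sub_const _).aemeasurable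
  have hindn : iIndepFun (fun (j : Fin N) (x : Fin N → S) => -(f (x j) - ν.real A)) μ :=
    iIndepFun_pi (X := fun (_ : Fin N) (x : S) => -(f x - ν.real A))
      fun _ => (hf.sub_const _).neg.aemeasurable
  have hεN : 0 ≤ ε * N := by positivity
  have hup := HasSubgaussianMGF.measure_sum_ge_le_of_iIndepFun hind (s := Finset.univ) (fun j _ => hsubj j) hεN
  have hlo := HasSubgaussianMGF.measure_sum_ge_le_of_iIndepFun hindn (s := Finset.univ)
    (fun j _ => (hsubj j).neg) hεN
  have hexp : Real.exp (-(ε * N) ^ 2 /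
      (2 * ∑ _j : Fin N, (((‖(1 : ℝ) - 0‖₊ / 2) ^ 2 : NNReal) : ℝ))) =
      Real.exp (-(2 * ε ^ 2) * N) := by
    congr 1
    rcases Nat.eq_zero_or_pos N with rfl | hN
    · simp
    · have : (N : ℝ) ≠ 0 := by positivity
      simp
      field_simp
  push_cast at hexp
  push_cast at hup hlo
  rw [hexp] at hup hlo
  calc _ ≤ μ.real ({x | ε * N ≤ ∑ j, (f (x j) - ν.real A)} ∪
        {x | ε * N ≤ ∑ j, -(f (x j) - ν.real A)}) := by
        refine measureReal_mono fun x hx => ?_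
        have e : ∑ j, (f (x j) - ν.real A) = ∑ j, f (x j) - ν.real A * N := by
          simp [Finset.sum_sub_distrib, mul_comm]
        rcases le_abs.1 (show ε * N ≤ |∑ j, f (x j) - ν.real A * N| from hx) with h | h
        · left
          show ε * N ≤ ∑ j, (f (x j) - ν.real A)
          rwa [e]
        · right
          show ε * N ≤ ∑ j, -(f (x j) - ν.real A)
          rwa [Finset.sum_neg_distrib, e]
    _ ≤ _ := measureReal_union_le _ _
    _ ≤ _ := by linarith

/-- For independent variables of colour `i` with weights `w i`, the number of boxes with content
`s` concentrates exponentially. -/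
theorem sum_prod_weight_le {K N : ℕ} {w : Fin K → ℕ → ℝ} (hw : ∀ i k, 0 ≤ w i k)
    (h1 : ∀ i, HasSum (w i) 1) (s : Fin K → ℕ) {ε : ℝ} (hε : 0 ≤ ε)
    (T : Finset (Fin K → Fin N → ℕ))
    (hT : ∀ k ∈ T, ε * N ≤
      |((∑ j, if ∀ i, k i j = s i then 1 else 0 : ℕ) : ℝ) - (∏ i, w i (s i)) * N|) :
    ∑ k ∈ T, ∏ i, ∏ j, w i (k i j) ≤ 2 * Real.exp (-(2 * ε ^ 2) * N) := by
  have := fun i => isProbabilityMeasure_weightMeasure (hw i) (h1 i)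
  set ν : Measure (Fin K → ℕ) := Measure.pi fun i => weightMeasure (w i)
  set μ : Measure (Fin N → Fin K → ℕ) := Measure.pi fun _ => ν
  have hν : ∀ t : Fin K → ℕ, ν.real {t} = ∏ i, w i (t i) := by
    intro t
    rw [measureReal_def, Measure.pi_singleton, ENNReal.toReal_prod]
    simp [weightMeasure_singleton, ENNReal.toReal_ofReal, hw]
  have hμ : ∀ t : Fin N → Fin K → ℕ, μ.real {t} = ∏ j, ∏ i, w i (t j i) := by
    intro t
    rw [measureReal_def, Measure.pi_singleton, ENNReal.toReal_prod]
    simp [← measureReal_def, hν]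
  -- Transposition: listed by box, the columns are i.i.d. vectors with law `ν`, and the count is
  -- that of the columns equal to `s`.
  have hinj : Function.Injective fun (k : Fin K → Fin N → ℕ) (j : Fin N) (i : Fin K) => k i j :=
    fun k k' h => by
      funext i j
      exact congrFun (congrFun h j) i
  set T' := T.map ⟨_, hinj⟩
  have hsum : ∑ k ∈ T, ∏ i, ∏ j, w i (k i j) = μ.real (T' : Set (Fin N → Fin K → ℕ)) := by
    rw [← sum_measureReal_singleton, Finset.sum_map]
    refine Finset.sum_congr rfl fun k _ => ?_
    rw [Finset.prod_comm, hμ]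
    rfl
  rw [hsum]
  refine le_trans (measureReal_mono fun x hx => ?_)
    (measureReal_abs_count_sub_le ν (measurableSet_singleton s) hε)
  obtain ⟨k, hk, rfl⟩ := Finset.mem_map.1 (Finset.mem_coe.1 hx)
  have := hT k hk
  show ε * N ≤ _
  refine this.trans (le_of_eq ?_)
  rw [hν]
  congr 2
  push_cast
  refine Finset.sum_congr rfl fun j _ => ?_
  simp [Set.indicator_apply, funext_iff]

/-! ### Power series distributions. -/

theorem genFun_pos {b : ℕ → ℝ} (hb : ∀ k, 0 ≤ b k) (hb0 : 0 < b 0) {θ : ℝ} (hθ : 0 < θ)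
    (hs : Summable fun k : ℕ => b k * θ ^ k / (k ! : ℝ)) : 0 < genFun b θ :=
  hs.tsum_pos (fun k => div_nonneg (mul_nonneg (hb k) (pow_nonneg hθ.le k)) (Nat.cast_nonneg _)) 0
    (by simpa using hb0)

theorem weight_eq_div (b : ℕ → ℝ) (θ : ℝ) (k : ℕ) :
    weight b θ k = b k * θ ^ k / (k ! : ℝ) / genFun b θ := by
  rw [weight, div_div]

theorem weight_nonneg {b : ℕ → ℝ} (hb : ∀ k, 0 ≤ b k) {θ : ℝ} (hθ : 0 < θ)
    (k : ℕ) : 0 ≤ weight b θ k := by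
  have h : ∀ k : ℕ, 0 ≤ b k * θ ^ k / (k ! : ℝ) := fun k =>
    div_nonneg (mul_nonneg (hb k) (pow_nonneg hθ.le k)) (Nat.cast_nonneg _)
  rw [weight_eq_div]
  exact div_nonneg (h k) (tsum_nonneg h)

theorem weight_pos {b : ℕ → ℝ} {θ : ℝ} (hθ : 0 < θ) (hB : 0 < genFun b θ) {k : ℕ}
    (hk : 0 < b k) : 0 < weight b θ k := by
  rw [weight]
  have := Nat.factorial_pos k
  positivity

theorem hasSum_weight {b : ℕ → ℝ} {θ : ℝ} (hB : 0 < genFun b θ)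
    (hs : Summable fun k : ℕ => b k * θ ^ k / (k ! : ℝ)) : HasSum (weight b θ) 1 := by
  have h := hs.hasSum.div_const (genFun b θ)
  rw [show (∑' k : ℕ, b k * θ ^ k / (k ! : ℝ)) = genFun b θ from rfl, div_self hB.ne'] at h
  exact h.congr_fun fun k => weight_eq_div b θ k

/-- Being strictly inside the radius of convergence gives geometric decay at `θ` itself, which
serves both the normalising series and the first moment. -/
theorem exists_geometric_bound {b : ℕ → ℝ} (hb : ∀ k, 0 ≤ b k) {θ : ℝ} (hθ : 0 < θ)
    (hR : ENNReal.ofReal θ < convRadius b) :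
    ∃ a C : ℝ, 0 < a ∧ a < 1 ∧ ∀ k : ℕ, b k * θ ^ k / (k ! : ℝ) ≤ C * a ^ k := by
  obtain ⟨a, ⟨ha0, ha1⟩, C, -, h⟩ :=
    FormalMultilinearSeries.norm_mul_pow_le_mul_pow_of_lt_radius _ (r := θ.toNNReal) hR
  refine ⟨a, C, ha0, ha1, fun k => ?_⟩
  have := h k
  rw [FormalMultilinearSeries.ofScalars_norm, Real.coe_toNNReal _ hθ.le,
    Real.norm_of_nonneg (div_nonneg (hb k) (Nat.cast_nonneg _))] at this
  rwa [mul_div_right_comm]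

theorem summable_of_lt_convRadius {b : ℕ → ℝ} (hb : ∀ k, 0 ≤ b k) {θ : ℝ} (hθ : 0 < θ)
    (hR : ENNReal.ofReal θ < convRadius b) :
    Summable fun k : ℕ => b k * θ ^ k / (k ! : ℝ) := by
  obtain ⟨a, C, ha0, ha1, h⟩ := exists_geometric_bound hb hθ hR
  exact Summable.of_nonneg_of_le
    (fun k => div_nonneg (mul_nonneg (hb k) (pow_nonneg hθ.le k)) (Nat.cast_nonneg _)) h
    ((summable_geometric_of_lt_one ha0.le ha1).mul_left C)

theorem hasSum_mean {b : ℕ → ℝ} (hb : ∀ k, 0 ≤ b k) {θ : ℝ} (hθ : 0 < θ)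
    (hR : ENNReal.ofReal θ < convRadius b) :
    HasSum (fun k : ℕ => (k : ℝ) * weight b θ k) (mean b θ) := by
  obtain ⟨a, C, ha0, ha1, h⟩ := exists_geometric_bound hb hθ hR
  have hg : Summable fun k : ℕ => (k : ℝ) ^ 1 * a ^ k :=
    summable_pow_mul_geometric_of_norm_lt_one 1 (by rwa [Real.norm_of_nonneg ha0.le])
  have hs : Summable fun k : ℕ => (k : ℝ) * (b k * θ ^ k / (k ! : ℝ)) := by
    refine Summable.of_nonneg_of_le (fun k => mul_nonneg (Nat.cast_nonneg k)
      (div_nonneg (mul_nonneg (hb k) (pow_nonneg hθ.le k)) (Nat.cast_nonneg _)))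
      (fun k => ?_) (hg.mul_left C)
    calc (k : ℝ) * (b k * θ ^ k / (k ! : ℝ)) ≤ k * (C * a ^ k) :=
          mul_le_mul_of_nonneg_left (h k) (Nat.cast_nonneg k)
      _ = C * ((k : ℝ) ^ 1 * a ^ k) := by ring
  refine Summable.hasSum ((hs.div_const (genFun b θ)).congr fun k => ?_)
  rw [weight_eq_div, mul_div_assoc]

/-! ### Comparison of the scheme with independent variables. -/

/-- Conditionally on their sum, power series distributed variables do not depend on the
parameter: the joint weights for two parameters are proportional. -/
theorem exists_prod_weight_eq {b : ℕ → ℝ} {θ θ' : ℝ} (hθ : 0 < θ) (hθ' : 0 < θ')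
    (hB : 0 < genFun b θ) (hB' : 0 < genFun b θ') (N n : ℕ) :
    ∃ c : ℝ, 0 < c ∧ ∀ k ∈ Finset.piAntidiag (Finset.univ : Finset (Fin N)) n,
      ∏ j, weight b θ (k j) = c * ∏ j, weight b θ' (k j) := by
  -- The parameter enters a configuration only through `θ ^ (∑ j, k j) = θ ^ n` and the
  -- normalisation.
  refine ⟨(θ / θ') ^ n * (genFun b θ' / genFun b θ) ^ N, by positivity, fun k hk => ?_⟩
  have hn : ∑ j, k j = n := (Finset.mem_piAntidiag.1 hk).1
  have e : ∀ m, weight b θ m = (θ / θ') ^ m * (genFun b θ' / genFun b θ) * weight b θ' m := by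
    intro m
    rw [weight, weight, div_pow]
    have := Nat.factorial_pos m
    field_simp
  simp_rw [e]
  rw [Finset.prod_mul_distrib, Finset.prod_mul_distrib, Finset.prod_pow_eq_pow_sum, hn,
    Finset.prod_const, Finset.card_univ, Fintype.card_fin]

/-- The same `c` serves the total and every configuration with that total, so it cancels in the
conditional law. -/
theorem exists_law_eq {Ω : Type*} [MeasurableSpace Ω] {Q : Measure Ω} [IsProbabilityMeasure Q]
    {K N : ℕ} {b : Fin K → ℕ → ℝ} {θ θ₀ : Fin K → ℝ} {ξ : Fin K → Fin N → Ω → ℕ}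
    (hξ : IsPowerSeriesArray Q b θ ξ) (hb : ∀ i k, 0 ≤ b i k) (hb0 : ∀ i, 0 < b i 0)
    (hθ₀ : ∀ i, 0 < θ₀ i) (hB₀ : ∀ i, 0 < genFun (b i) (θ₀ i)) (i : Fin K) (n : ℕ) :
    ∃ c : ℝ, 0 < c ∧
      Q.real (totalEvent ξ i n) = c * totalWeight (weight (b i) (θ₀ i)) N n ∧
      ∀ k ∈ Finset.piAntidiag (Finset.univ : Finset (Fin N)) n,
        Q.real {ω | ∀ j, ξ i j ω = k j} = c * ∏ j, weight (b i) (θ₀ i) (k j) := by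
  obtain ⟨c, hc, h⟩ := exists_prod_weight_eq (hξ.param_pos i) (hθ₀ i)
    (genFun_pos (hb i) (hb0 i) (hξ.param_pos i) (hξ.summable i)) (hB₀ i) N n
  have hind : iIndepFun (ξ i) Q :=
    hξ.indep.precomp (g := fun j : Fin N => (i, j)) fun j j' hjj' => (Prod.mk.inj hjj').2
  refine ⟨c, hc, ?_, fun k hk => ?_⟩
  · rw [totalEvent, measureReal_sum_eq (hξ.measurable i) hind (hξ.law i), totalWeight, totalWeight,
      Finset.mul_sum]
    exact Finset.sum_congr rfl h
  · rw [measureReal_forall_eq hind, ← h k hk]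
    exact Finset.prod_congr rfl fun j _ => hξ.law i j _

theorem measurableSet_totalEvent {Ω : Type*} [MeasurableSpace Ω] {K N : ℕ}
    {ξ : Fin K → Fin N → Ω → ℕ} (hξ : ∀ i j, Measurable (ξ i j)) (i : Fin K) (n : ℕ) :
    MeasurableSet (totalEvent ξ i n) :=
  (Finset.measurable_sum Finset.univ fun j _ => hξ i j) (measurableSet_singleton n)

theorem cond_totalEvent_eq {Ω : Type*} [MeasurableSpace Ω] {Q : Measure Ω} [IsProbabilityMeasure Q]
    {K N : ℕ} {b : Fin K → ℕ → ℝ} {θ θ₀ : Fin K → ℝ} {ξ : Fin K → Fin N → Ω → ℕ}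
    (hξ : IsPowerSeriesArray Q b θ ξ) (hb : ∀ i k, 0 ≤ b i k) (hb0 : ∀ i, 0 < b i 0)
    (hθ₀ : ∀ i, 0 < θ₀ i) (hB₀ : ∀ i, 0 < genFun (b i) (θ₀ i)) (i : Fin K) (n : ℕ)
    {k : Fin N → ℕ} (hk : ∑ j, k j = n) :
    (ProbabilityTheory.cond Q (totalEvent ξ i n) {ω | ∀ j, ξ i j ω = k j}).toReal =
      (∏ j, weight (b i) (θ₀ i) (k j)) / totalWeight (weight (b i) (θ₀ i)) N n := by
  obtain ⟨c, hc, ht, hl⟩ := exists_law_eq hξ hb hb0 hθ₀ hB₀ i n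
  have hsub : {ω | ∀ j, ξ i j ω = k j} ⊆ totalEvent ξ i n := by
    intro ω hω
    show ∑ j, ξ i j ω = n
    rw [← hk]
    exact Finset.sum_congr rfl fun j _ => hω j
  rw [cond_apply (measurableSet_totalEvent hξ.measurable i n), Set.inter_eq_right.2 hsub,
    ENNReal.toReal_mul, ENNReal.toReal_inv, ← measureReal_def, ← measureReal_def, ht,
    hl k (by simp [hk]), mul_inv, div_eq_mul_inv]
  field_simp

/-- An event has in the allocation scheme at most its probability for independent variables divided
by the probability of the conditioning event. -/
theorem measureReal_scheme_le {Ω Ω' : Type*} [MeasurableSpace Ω] [MeasurableSpace Ω']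
    {P : Measure Ω} [IsProbabilityMeasure P] {Q : Measure Ω'} [IsProbabilityMeasure Q]
    {K N : ℕ} {n : Fin K → ℕ} {b : Fin K → ℕ → ℝ} {θ θ₀ : Fin K → ℝ}
    {ξ : Fin K → Fin N → Ω' → ℕ} {η : Fin K → Fin N → Ω → ℕ}
    (hξ : IsPowerSeriesArray Q b θ ξ) (hη : IsAllocationScheme P Q n ξ η)
    (hb : ∀ i k, 0 ≤ b i k) (hb0 : ∀ i, 0 < b i 0)
    (hθ₀ : ∀ i, 0 < θ₀ i) (hB₀ : ∀ i, 0 < genFun (b i) (θ₀ i))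
    (hpos : ∀ i, 0 < totalWeight (weight (b i) (θ₀ i)) N (n i))
    (E : Set (Fin K → Fin N → ℕ)) {B : ℝ}
    (hE : ∀ T : Finset (Fin K → Fin N → ℕ), (∀ k ∈ T, k ∈ E) →
      ∑ k ∈ T, ∏ i, ∏ j, weight (b i) (θ₀ i) (k i j) ≤ B) :
    P.real {ω | (fun i j => η i j ω) ∈ E} ≤
      B / ∏ i, totalWeight (weight (b i) (θ₀ i)) N (n i) := by
  classical
  set D := ∏ i, totalWeight (weight (b i) (θ₀ i)) N (n i)
  have hD : 0 < D := Finset.prod_pos fun i _ => hpos i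
  set F : Finset (Fin K → Fin N → ℕ) :=
    Fintype.piFinset fun i => Finset.piAntidiag (Finset.univ : Finset (Fin N)) (n i)
  have hF : ∀ k ∈ F, ∀ i, ∑ j, k i j = n i := fun k hk i =>
    (Finset.mem_piAntidiag.1 (Fintype.mem_piFinset.1 hk i)).1
  set A : (Fin K → Fin N → ℕ) → Set Ω := fun k => {ω | ∀ i j, η i j ω = k i j}
  have hAm : ∀ k, MeasurableSet (A k) := by
    intro k
    simp only [A, Set.ofPred_forall]
    exact MeasurableSet.iInter fun i => MeasurableSet.iInter fun j =>
      hη.measurable i j (measurableSet_singleton _)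
  have hAd : ∀ T : Finset (Fin K → Fin N → ℕ), (T : Set _).PairwiseDisjoint A := by
    intro T k _ k' _ hkk'
    refine Set.disjoint_left.2 fun ω h h' => hkk' ?_
    funext i j
    exact (h i j).symm.trans (h' i j)
  have hA : ∀ k ∈ F, P.real (A k) = (∏ i, ∏ j, weight (b i) (θ₀ i) (k i j)) / D := by
    intro k hk
    rw [measureReal_def, hη.joint_law k (hF k hk), ENNReal.toReal_prod, ← Finset.prod_div_distrib]
    exact Finset.prod_congr rfl fun i _ =>
      cond_totalEvent_eq hξ hb hb0 hθ₀ hB₀ i (n i) (hF k hk i)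
  have hsum : ∑ k ∈ F, ∏ i, ∏ j, weight (b i) (θ₀ i) (k i j) = D :=
    (Finset.prod_univ_sum _ fun i (x : Fin N → ℕ) => ∏ j, weight (b i) (θ₀ i) (x j)).symm
  -- The joint law is prescribed only on arrays with the right totals; these already carry mass one,
  -- so all other arrays are null.
  have hone : P.real (⋃ k ∈ F, A k) = 1 := by
    rw [measureReal_biUnion_finset (hAd F) fun k _ => hAm k, Finset.sum_congr rfl hA,
      ← Finset.sum_div, hsum, div_self hD.ne']
  have hzero : P.real (⋃ k ∈ F, A k)ᶜ = 0 := by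
    rw [probReal_compl_eq_one_sub (F.measurableSet_biUnion fun k _ => hAm k), hone, sub_self]
  calc P.real {ω | (fun i j => η i j ω) ∈ E}
      ≤ P.real ((⋃ k ∈ F.filter (· ∈ E), A k) ∪ (⋃ k ∈ F, A k)ᶜ) := by
        refine measureReal_mono fun ω hω => ?_
        by_cases h : ω ∈ ⋃ k ∈ F, A k
        · left
          obtain ⟨k, hk, hωk⟩ := Set.mem_iUnion₂.1 h
          have e : (fun i j => η i j ω) = k := by
            funext i j
            exact hωk i j
          refine Set.mem_iUnion₂.2 ⟨k, Finset.mem_filter.2 ⟨hk, ?_⟩, hωk⟩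
          rw [← e]
          exact hω
        · exact Or.inr h
    _ ≤ P.real (⋃ k ∈ F.filter (· ∈ E), A k) + P.real (⋃ k ∈ F, A k)ᶜ := measureReal_union_le _ _
    _ = (∑ k ∈ F.filter (· ∈ E), ∏ i, ∏ j, weight (b i) (θ₀ i) (k i j)) / D := by
        rw [hzero, add_zero, measureReal_biUnion_finset (hAd _) fun k _ => hAm k, Finset.sum_div]
        exact Finset.sum_congr rfl fun k hk => hA k (Finset.mem_filter.1 hk).1
    _ ≤ B / D := div_le_div_of_nonneg_right (hE _ fun k hk => (Finset.mem_filter.1 hk).2) hD.le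

/-! ### The limit regime and Borel–Cantelli. -/

theorem tendsto_snd_regime {K : ℕ} (α : Fin K → ℝ) :
    Tendsto (fun p : (Fin K → ℕ) × ℕ => p.2) (regime α) atTop :=
  tendsto_comap.mono_left inf_le_left

theorem tendsto_ratio_regime {K : ℕ} (α : Fin K → ℝ) (i : Fin K) :
    Tendsto (fun p : (Fin K → ℕ) × ℕ => (p.1 i : ℝ) / (p.2 : ℝ)) (regime α) (𝓝 (α i)) :=
  tendsto_comap.mono_left (inf_le_right.trans (inf_le_right.trans (iInf_le _ i)))

theorem summable_linear_pow_mul_exp (C K : ℕ) {c : ℝ} (hc : 0 < c) :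
    Summable fun N : ℕ => ((C * N + 1 : ℕ) : ℝ) ^ K * (2 * Real.exp (-c * N)) := by
  have hr : ‖Real.exp (-c)‖ < 1 := by
    rw [Real.norm_of_nonneg (Real.exp_nonneg _), Real.exp_lt_one_iff]
    linarith
  refine Summable.of_norm_bounded_eventually_nat
    ((summable_pow_mul_geometric_of_norm_lt_one K hr).mul_left (((C + 1 : ℕ) : ℝ) ^ K * 2)) ?_
  filter_upwards [eventually_ge_atTop 1] with N hN
  rw [Real.norm_of_nonneg (by positivity), ← Real.exp_nat_mul, mul_comm (N : ℝ) (-c)]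
  have h : ((C * N + 1 : ℕ) : ℝ) ^ K ≤ (((C + 1 : ℕ) : ℝ) * N) ^ K := by
    refine pow_le_pow_left₀ (Nat.cast_nonneg _) ?_ K
    have : C * N + 1 ≤ (C + 1) * N := by rw [add_mul]; omega
    exact_mod_cast this
  calc ((C * N + 1 : ℕ) : ℝ) ^ K * (2 * Real.exp (-c * N))
      ≤ (((C + 1 : ℕ) : ℝ) * N) ^ K * (2 * Real.exp (-c * N)) :=
        mul_le_mul_of_nonneg_right h (by positivity)
    _ = _ := by rw [mul_pow]; ring

/-- If, uniformly over `n` with `n i` close to `α i * N`, deviations of size `ε` have exponentially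
small probability, then almost surely they do not occur eventually in the limit regime. -/
theorem ae_eventually_regime_abs_sub_lt {Ω : Type*} [MeasurableSpace Ω] {P : Measure Ω}
    [IsProbabilityMeasure P] {K : ℕ} {α : Fin K → ℝ} {X : (Fin K → ℕ) → ℕ → Ω → ℝ} {p ε c : ℝ}
    (hc : 0 < c) {ρ : Fin K → ℝ} (hρ : ∀ i, 0 < ρ i)
    (h : ∀ᶠ N : ℕ in atTop, ∀ n : Fin K → ℕ, (∀ i, |(n i : ℝ) - α i * N| ≤ ρ i * N) →
      P.real {ω | ε * N ≤ |X n N ω - p * N|} ≤ 2 * Real.exp (-c * N)) :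
    ∀ᵐ ω ∂P, ∀ᶠ x in regime α, |X x.1 x.2 ω / (x.2 : ℝ) - p| < ε := by
  classical
  set C : ℕ := ∑ i, ⌈α i + ρ i⌉₊
  have hC : ∀ i, α i + ρ i ≤ C := by
    intro i
    refine (Nat.le_ceil _).trans ?_
    exact_mod_cast Finset.single_le_sum (f := fun i => ⌈α i + ρ i⌉₊) (fun _ _ => Nat.zero_le _)
      (Finset.mem_univ i)
  set G : ℕ → Finset (Fin K → ℕ) := fun N =>
    (Fintype.piFinset fun _ => Finset.range (C * N + 1)).filter
      fun n => ∀ i, |(n i : ℝ) - α i * N| ≤ ρ i * N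
  have hG : ∀ (N : ℕ) (n : Fin K → ℕ), (∀ i, |(n i : ℝ) - α i * N| ≤ ρ i * N) → n ∈ G N := by
    intro N n hn
    refine Finset.mem_filter.2 ⟨Fintype.mem_piFinset.2 fun i => Finset.mem_range.2 ?_, hn⟩
    have h1 : (n i : ℝ) ≤ C * N := by
      have := (abs_le.1 (hn i)).2
      have := mul_le_mul_of_nonneg_right (hC i) (Nat.cast_nonneg (α := ℝ) N)
      linarith
    have h2 : n i ≤ C * N := by exact_mod_cast h1
    omega
  -- Uniting over all admissible `n` leaves one event per `N`; this is what makes the limit hold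
  -- along every sequence of pairs.
  set bad : ℕ → Set Ω := fun N => ⋃ n ∈ G N, {ω | ε * N ≤ |X n N ω - p * N|}
  have hbad : ∀ᶠ N : ℕ in atTop,
      ‖P.real (bad N)‖ ≤ ((C * N + 1 : ℕ) : ℝ) ^ K * (2 * Real.exp (-c * N)) := by
    filter_upwards [h] with N hN
    rw [Real.norm_of_nonneg measureReal_nonneg]
    calc P.real (bad N) ≤ ∑ n ∈ G N, P.real {ω | ε * N ≤ |X n N ω - p * N|} :=
          measureReal_biUnion_finset_le _ _
      _ ≤ ∑ _n ∈ G N, 2 * Real.exp (-c * N) :=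
          Finset.sum_le_sum fun n hn => hN n (Finset.mem_filter.1 hn).2
      _ = ((G N).card : ℝ) * (2 * Real.exp (-c * N)) := by rw [Finset.sum_const, nsmul_eq_mul]
      _ ≤ _ := by
          refine mul_le_mul_of_nonneg_right ?_ (by positivity)
          have : (G N).card ≤ (C * N + 1) ^ K := by
            refine (Finset.card_filter_le _ _).trans (le_of_eq ?_)
            simp
          exact_mod_cast this
  have hsum : Summable fun N => P.real (bad N) :=
    Summable.of_norm_bounded_eventually_nat (summable_linear_pow_mul_exp C K hc) hbad
  have hne : ∑' N, P (bad N) ≠ ∞ := by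
    have := hsum.tsum_ofReal_ne_top
    simp_rw [ofReal_measureReal (measure_ne_top P _)] at this
    exact this
  filter_upwards [ae_eventually_notMem hne] with ω hω
  have hratio : ∀ᶠ x in regime α, ∀ i, |(x.1 i : ℝ) / (x.2 : ℝ) - α i| < ρ i :=
    eventually_all.2 fun i => (tendsto_ratio_regime α i).eventually
      (Metric.ball_mem_nhds (α i) (hρ i))
  filter_upwards [(tendsto_snd_regime α).eventually hω,
    (tendsto_snd_regime α).eventually (eventually_gt_atTop 0), hratio] with x hx hx0 hxr
  have hN : (0 : ℝ) < x.2 := by exact_mod_cast hx0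
  have hscale : ∀ u v : ℝ, |u - v * x.2| = |u / x.2 - v| * x.2 := by
    intro u v
    rw [← abs_of_pos hN, ← abs_mul, abs_of_pos hN, sub_mul, div_mul_cancel₀ _ hN.ne']
  have hxG : x.1 ∈ G x.2 := hG _ _ fun i => by
    rw [hscale]
    exact mul_le_mul_of_nonneg_right (hxr i).le hN.le
  by_contra hcon
  refine hx (Set.mem_iUnion₂.2 ⟨x.1, hxG, ?_⟩)
  show ε * x.2 ≤ |X x.1 x.2 ω - p * x.2|
  rw [hscale]
  exact mul_le_mul_of_nonneg_right (not_lt.1 hcon) hN.le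

end ColouredAllocation

/-! ### Proof of the strong law. -/

/-- For each numbers-of-balls vector `n` and number of boxes `N`, `η n N` is a multi-colour
generalized allocation scheme, all of them on one probability space and with no assumption on their
joint behaviour; `(n, N)` is exempt if a conditioning event has probability zero, when no such
scheme exists. -/
theorem theorem1p3
    {Ω Ω' : Type*} [MeasurableSpace Ω] [MeasurableSpace Ω']
    (P : Measure Ω) [IsProbabilityMeasure P] (Q : Measure Ω') [IsProbabilityMeasure Q]
    (K : ℕ) (hK : 0 < K)
    (b : Fin K → ℕ → ℝ) (hb : ∀ i k, 0 ≤ b i k) (hb0 : ∀ i, 0 < b i 0) (hb1 : ∀ i, 0 < b i 1)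
    (θ : (Fin K → ℕ) → ℕ → Fin K → ℝ)
    (ξ : (Fin K → ℕ) → (N : ℕ) → Fin K → Fin N → Ω' → ℕ)
    (hξ : ∀ n N, ColouredAllocation.IsPowerSeriesArray Q b (θ n N) (ξ n N))
    (η : (Fin K → ℕ) → (N : ℕ) → Fin K → Fin N → Ω → ℕ)
    (hη : ∀ n N, (∀ i, Q (ColouredAllocation.totalEvent (ξ n N) i (n i)) ≠ 0) →
      ColouredAllocation.IsAllocationScheme P Q n (ξ n N) (η n N))
    (s : Fin K → ℕ) (α₀ θ₀ : Fin K → ℝ)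
    (hθ₀ : ∀ i, 0 < θ₀ i)
    (hθ₀R : ∀ i, ENNReal.ofReal (θ₀ i) < ColouredAllocation.convRadius (b i))
    (hα₀ : ∀ i, ColouredAllocation.mean (b i) (θ₀ i) = α₀ i) :
    ∀ᵐ ω ∂P, Tendsto
      (fun p : (Fin K → ℕ) × ℕ =>
        (ColouredAllocation.boxCount (η p.1 p.2) s ω : ℝ) / (p.2 : ℝ))
      (ColouredAllocation.regime α₀)
      (𝓝 (∏ i, b i (s i) * θ₀ i ^ s i / ((s i)! * ColouredAllocation.genFun (b i) (θ₀ i)))) := by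
  have hs i := ColouredAllocation.summable_of_lt_convRadius (hb i) (hθ₀ i) (hθ₀R i)
  have hB i := ColouredAllocation.genFun_pos (hb i) (hb0 i) (hθ₀ i) (hs i)
  have hw i := ColouredAllocation.weight_nonneg (hb i) (hθ₀ i)
  have h1 i := ColouredAllocation.hasSum_weight (hB i) (hs i)
  have hm : ∀ i, HasSum (fun k : ℕ => (k : ℝ) * ColouredAllocation.weight (b i) (θ₀ i) k) (α₀ i) :=
    fun i => hα₀ i ▸ ColouredAllocation.hasSum_mean (hb i) (hθ₀ i) (hθ₀R i)
  set p : ℝ := ∏ i, b i (s i) * θ₀ i ^ s i / ((s i)! * ColouredAllocation.genFun (b i) (θ₀ i))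
  have key : ∀ ε : ℝ, 0 < ε → ∀ᵐ ω ∂P, ∀ᶠ x in ColouredAllocation.regime α₀,
      |(ColouredAllocation.boxCount (η x.1 x.2) s ω : ℝ) / (x.2 : ℝ) - p| < ε := by
    intro ε hε
    have hK' : (0 : ℝ) < K := by exact_mod_cast hK
    -- The `K` lower bounds multiply to `exp (-ε² N)`, half of Hoeffding's exponent.
    have hδ : 0 < ε ^ 2 / K := by positivity
    choose ρ hρ hlow using fun i => ColouredAllocation.exp_neg_le_totalWeight (hw i) (h1 i)
      (ColouredAllocation.weight_pos (hθ₀ i) (hB i) (hb0 i))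
      (ColouredAllocation.weight_pos (hθ₀ i) (hB i) (hb1 i)) (hm i) hδ
    refine ColouredAllocation.ae_eventually_regime_abs_sub_lt
      (X := fun n N ω => (ColouredAllocation.boxCount (η n N) s ω : ℝ)) (c := ε ^ 2)
      (by positivity) hρ ?_
    filter_upwards [eventually_all.2 hlow] with N hN n hn
    have hZ : ∀ i, Real.exp (-(ε ^ 2 / K) * N) ≤ ColouredAllocation.totalWeight
        (ColouredAllocation.weight (b i) (θ₀ i)) N (n i) := fun i => hN i (n i) (hn i)
    have hZpos i := (Real.exp_pos _).trans_le (hZ i)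
    -- The lower bound under `θ₀` transfers to the actual parameters through `c > 0`, so no pair
    -- considered here is exempt.
    have hcond : ∀ i, Q (ColouredAllocation.totalEvent (ξ n N) i (n i)) ≠ 0 := by
      intro i h0
      obtain ⟨c, hc, ht, -⟩ :=
        ColouredAllocation.exists_law_eq (hξ n N) hb hb0 hθ₀ hB i (n i)
      rw [measureReal_def, h0, ENNReal.toReal_zero] at ht
      exact (mul_pos hc (hZpos i)).ne ht
    have hprod : Real.exp (-ε ^ 2 * N) ≤ ∏ i, ColouredAllocation.totalWeight
        (ColouredAllocation.weight (b i) (θ₀ i)) N (n i) := by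
      calc Real.exp (-ε ^ 2 * N) = ∏ _i : Fin K, Real.exp (-(ε ^ 2 / K) * N) := by
            rw [Finset.prod_const, Finset.card_univ, Fintype.card_fin, ← Real.exp_nat_mul]
            congr 1
            field_simp
        _ ≤ _ := Finset.prod_le_prod (fun _ _ => (Real.exp_pos _).le) fun i _ => hZ i
    have hscheme := ColouredAllocation.measureReal_scheme_le (hξ n N) (hη n N hcond) hb hb0 hθ₀ hB
      hZpos {k | ε * N ≤ |((∑ j, if ∀ i, k i j = s i then 1 else 0 : ℕ) : ℝ) - p * N|}
      fun T hT => ColouredAllocation.sum_prod_weight_le hw h1 s hε.le T hT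
    refine (le_trans hscheme ?_)
    rw [div_le_iff₀ ((Real.exp_pos _).trans_le hprod)]
    calc 2 * Real.exp (-(2 * ε ^ 2) * N)
        = 2 * Real.exp (-ε ^ 2 * N) * Real.exp (-ε ^ 2 * N) := by
          rw [mul_assoc, ← Real.exp_add]
          ring_nf
      _ ≤ _ := mul_le_mul_of_nonneg_left hprod (by positivity)
  -- Countably many tolerances allow a single null set.
  have hall : ∀ᵐ ω ∂P, ∀ m : ℕ, ∀ᶠ x in ColouredAllocation.regime α₀,
      |(ColouredAllocation.boxCount (η x.1 x.2) s ω : ℝ) / (x.2 : ℝ) - p| < 1 / ((m : ℝ) + 1) :=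
    ae_all_iff.2 fun m => key _ (by positivity)
  filter_upwards [hall] with ω hω
  refine Metric.tendsto_nhds.2 fun ε hε => ?_
  obtain ⟨m, hm⟩ := exists_nat_one_div_lt hε
  filter_upwards [hω m] with x hx
  rw [Real.dist_eq]
  exact hx.trans hm
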